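/- Let $k\ge 1$ and $n\ge k+1$ be integers. **Forces.** A *force system* consists of finitely many nondegenerate $(k-1)$-simplices $s_1,\dots,s_l$ in $\mathbb R^n$ (arbitrary, possibly overlapping) and constant vectors $\mathbf F_1,\dots,\mathbf F_l\in\mathbb R^n$, the force $\mathbf F_i$ being distributed uniformly over $s_i$. It is *in equilibrium* if its net force and its net torque vanish, $$\sum_{i=1}^l \mathbf F_i=0,\qquad \sum_{i=1}^l \mathbf F_i\wedge \hat s_i=0,$$ where $\hat s_i$ is the barycenter of $s_i$. **Beams.** Let $\sigma=[a_0,\dots,a_k]$ be a nondegenerate $k$-simplex in $\mathbb R^n$, with facets $\sigma_i$ (opposite to $a_i$), and let $\nu_i$ be the unit vector tangent to $\sigma$ that is normal to $\sigma_i$ and points out of $\sigma$. Let $A$ be a real symmetric $n\times n$ matrix (a constant Cauchy stress tensor). The stressed simplex $A\otimes\sigma$ is *structurally stressed* if every eigenvector of $A$ with nonzero eigenvalue lies in the tangent space of $\sigma$. In that case its boundary forces form the force system $$A\otimes \mathrm{Beam}(\sigma):\qquad \text{the force } \operatorname{area}(\sigma_i)\,A\nu_i \text{ distributed uniformly over }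 \sigma_i,\quad i=0,\dots,k,$$ where $\operatorname{area}$ is the $(k-1)$-dimensional area. Such a system is called a *$k$-beam*. **Theorem.** For every force system $(s_i,\mathbf F_i)_{i\le l}$ in equilibrium there are finitely many structurally stressed $k$-simplices $A_1\otimes\sigma^1,\dots,A_m\otimes\sigma^m$ in $\mathbb R^n$ such that the force system is the sum of the $k$-beams $A_j\otimes\mathrm{Beam}(\sigma^j)$. (Scalar coefficients of a linear combination are absorbed in the matrices $A_j$.) That is, with $\nu^j_i$ the outward unit normal of the facet $\sigma^j_i$, one has the identity of $\mathbb R^n$-valued measures $$\sum_{i=1}^l \mathbf F_i\,\frac{\mathcal H^{k-1}|_{s_i}}{\mathcal H^{k-1}(s_i)}=\sum_{j=1}^m\sum_{i=0}^k \operatorname{area}(\sigma^j_i)\,A_j\nu^j_i\;\frac{\mathcal H^{k-1}|_{\sigma^j_i}}{\mathcal H^{k-1}(\sigma^j_i)},$$ in which each $\mathbf F_i$ is the total force on $s_i$, and with the same beams also the identity without normalization $$\sum_{i=1}^l \mathbf F_i\,\mathcal H^{k-1}|_{s_i}=\sum_{j=1}^m\sum_{i=0}^k \operatorname{area}(\sigma^j_i)\,A_j\nu^j_i\;\mathcal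 H^{k-1}|_{\sigma^j_i}.$$ -/

import Mathlib

open MeasureTheory

noncomputable section

namespace Beams

variable {n : ℕ}

/-- A system of `l` constant forces `force i ∈ ℝⁿ`, the `i`-th one being distributed uniformly over
the (nondegenerate) `d`-simplex `simplex i`. -/
structure ForceSystem (n d l : ℕ) where
  simplex : Fin l → Affine.Simplex ℝ (EuclideanSpace ℝ (Fin n)) d
  force : Fin l → EuclideanSpace ℝ (Fin n)

/-- The wedge product `u ∧ v` of two vectors, as the skew-symmetric matrix `u vᵀ - v uᵀ`. -/
def wedge (u v : EuclideanSpace ℝ (Fin n)) : Matrix (Fin n) (Fin n) ℝ :=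
  Matrix.of fun p q => u p * v q - v p * u q

/-- Equilibrium: the net force and the net torque (about the barycenters) both vanish. -/
def ForceSystem.InEquilibrium {d l : ℕ} (S : ForceSystem n d l) : Prop :=
  ∑ i, S.force i = 0 ∧ ∑ i, wedge (S.force i) (S.simplex i).centroid = 0

/-- The vector measure `F · ℋᵈ|ₛ` (constant density `F`) carried by the closed `d`-simplex `s`;
`μHE[d]` is the `d`-dimensional Hausdorff measure with its Euclidean normalization. -/
def densityForce {d : ℕ} (s : Affine.Simplex ℝ (EuclideanSpace ℝ (Fin n)) d)
    (F : EuclideanSpace ℝ (Fin n)) :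
    VectorMeasure (EuclideanSpace ℝ (Fin n)) (EuclideanSpace ℝ (Fin n)) :=
  (μHE[d].restrict s.closedInterior).withDensityᵥ fun _ => F

/-- The vector measure `F · ℋᵈ|ₛ / ℋᵈ(s)`: the force of total amount `F` distributed uniformly over
the closed `d`-simplex `s`. -/
def uniformForce {d : ℕ} (s : Affine.Simplex ℝ (EuclideanSpace ℝ (Fin n)) d)
    (F : EuclideanSpace ℝ (Fin n)) :
    VectorMeasure (EuclideanSpace ℝ (Fin n)) (EuclideanSpace ℝ (Fin n)) :=
  (ProbabilityTheory.cond μHE[d] s.closedInterior).withDensityᵥ fun _ => F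

/-- The `d`-dimensional area `√(det Gram(a₁ - a₀, …, a_d - a₀)) / d!` of the simplex
`[a₀, …, a_d]`. -/
def area {d : ℕ} (s : Affine.Simplex ℝ (EuclideanSpace ℝ (Fin n)) d) : ℝ :=
  √(Matrix.gram ℝ fun j : Fin d => s.points j.succ - s.points 0).det / (d.factorial : ℝ)

/-- The unit normal to the facet of `σ` opposite to the vertex `i`, tangent to `σ` and pointing
out of `σ`: the normalized vector from the vertex `i` to the foot of its altitude. -/
def outwardNormal {k : ℕ} [NeZero k] (σ : Affine.Simplex ℝ (EuclideanSpace ℝ (Fin n)) k)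
    (i : Fin (k + 1)) : EuclideanSpace ℝ (Fin n) :=
  (σ.height i)⁻¹ • (σ.altitudeFoot i - σ.points i)

/-- A stressed `k`-simplex `A ⊗ σ` of `ℝⁿ`: a `k`-simplex `σ` with a symmetric `n × n` matrix `A`,
its (constant) Cauchy stress tensor. -/
structure StressedSimplex (n k : ℕ) where
  simplex : Affine.Simplex ℝ (EuclideanSpace ℝ (Fin n)) k
  stress : Matrix (Fin n) (Fin n) ℝ
  isSymm : stress.IsSymm

/-- `A ⊗ σ` is structurally stressed if all eigenvectors of `A` for nonzero eigenvalues lie in the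
tangent space of `σ`. -/
def StressedSimplex.IsStructural {k : ℕ} (P : StressedSimplex n k) : Prop :=
  ∀ (c : ℝ) (v : EuclideanSpace ℝ (Fin n)), c ≠ 0 → v ≠ 0 →
    Matrix.toEuclideanLin P.stress v = c • v →
      v ∈ (affineSpan ℝ (Set.range P.simplex.points)).direction

/-- The force that the stress `A` exerts on the facet of `σ` opposite to the vertex `i`:
`A` applied to the outward unit normal is the force per unit area. -/
def StressedSimplex.facetForce {k : ℕ} [NeZero k] (P : StressedSimplex n k) (i : Fin (k + 1)) :
    EuclideanSpace ℝ (Fin n) :=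
  area (P.simplex.faceOpposite i) •
    Matrix.toEuclideanLin P.stress (outwardNormal P.simplex i)

/-- The boundary forces of a stressed `k`-simplex, as a system of forces on its `k + 1` facets.
For a structurally stressed simplex this is the `k`-beam `A ⊗ Beam(σ)`. -/
def StressedSimplex.beam {k : ℕ} [NeZero k] (P : StressedSimplex n k) :
    ForceSystem n (k - 1) (k + 1) where
  simplex i := P.simplex.faceOpposite i
  force i := P.facetForce i

/-- The vector measure `∑ᵢ Fᵢ ℋᵈ|_{sᵢ}`. -/
def ForceSystem.densityMeasure {d l : ℕ} (S : ForceSystem n d l) :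
    VectorMeasure (EuclideanSpace ℝ (Fin n)) (EuclideanSpace ℝ (Fin n)) :=
  ∑ i, densityForce (S.simplex i) (S.force i)

/-- The vector measure `∑ᵢ Fᵢ ℋᵈ|_{sᵢ} / ℋᵈ(sᵢ)`. -/
def ForceSystem.uniformMeasure {d l : ℕ} (S : ForceSystem n d l) :
    VectorMeasure (EuclideanSpace ℝ (Fin n)) (EuclideanSpace ℝ (Fin n)) :=
  ∑ i, uniformForce (S.simplex i) (S.force i)

end Beams

end

/-! Let g(a, F) be the class, modulo sums of beams, of the force F on the simplex with vertices a. A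
beam with stress c e eᵀ, where e is an edge, loads only the two facets opposite the ends of e, and
with opposite forces along e. So F may be carried over to the simplex obtained by moving one vertex
by F itself (`forceClass_slide`). Together with linearity in F and independence of the order of the
vertices, this is all that is used about beams (`Sliding`).

These properties force g(a, w) = δ(w) + γ(∑ aᵢ, w) with γ alternating (`Sliding.exists_eq`). A force
system is thus seen only through its net force and net torque, and in equilibrium its class is zero.

For this formula, study the change of g(a, w) when one vertex moves by u. It is antisymmetric in u,
w, by polarizing the sliding rule; additivity of successive moves then makes it insensitive to
further moves of that vertex. For moves of two different vertices, the mixed second difference is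
both symmetric and antisymmetric in the displacements, hence zero. Sliding needs nondegenerate
simplices, so these steps use almost every displacement. Only pairs of vectors are ever required to
be transversal, since for n = k + 1 there is no room for three.

Both normalizations of the measures are treated at once, by taking classes of pairs of vector
measures. -/

noncomputable section

namespace Beams

open scoped RealInnerProductSpace

/-! ### Transversality of points and vectors -/

section Transversal

variable {V : Type*} [AddCommGroup V] [Module ℝ V] {ι : Type*} [Fintype ι]

/-- The points `a i` are affinely independent, and the vectors `x j` are linearly independent
modulo the direction of their affine span. -/
def Transversal {m : ℕ} (a : ι → V) (x : Fin m → V) : Prop :=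
  ∀ (α : ι → ℝ) (β : Fin m → ℝ), ∑ i, α i = 0 → ∑ i, α i • a i + ∑ j, β j • x j = 0 →
    α = 0 ∧ β = 0

lemma transversal_one {a : ι → V} {u : V} : Transversal a ![u] ↔
    ∀ (α : ι → ℝ) (β : ℝ), ∑ i, α i = 0 → ∑ i, α i • a i + β • u = 0 → α = 0 ∧ β = 0 := by
  constructor
  · intro h α β h0 h1
    have := h α ![β] h0 (by simpa using h1)
    exact ⟨this.1, by simpa using congrFun this.2 0⟩
  · intro h α β h0 h1
    have := h α (β 0) h0 (by simpa using h1)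
    refine ⟨this.1, ?_⟩
    ext j
    fin_cases j
    simpa using this.2

lemma transversal_two {a : ι → V} {u w : V} : Transversal a ![u, w] ↔
    ∀ (α : ι → ℝ) (β γ : ℝ), ∑ i, α i = 0 → ∑ i, α i • a i + (β • u + γ • w) = 0 →
      α = 0 ∧ β = 0 ∧ γ = 0 := by
  constructor
  · intro h α β γ h0 h1
    have := h α ![β, γ] h0 (by simpa using h1)
    exact ⟨this.1, by simpa using congrFun this.2 0, by simpa using congrFun this.2 1⟩
  · intro h α β h0 h1
    have := h α (β 0) (β 1) h0 (by simpa [Fin.sum_univ_two] using h1)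
    refine ⟨this.1, ?_⟩
    ext j
    fin_cases j
    · simpa using this.2.1
    · simpa using this.2.2

lemma Transversal.swap {a : ι → V} {u w : V} (h : Transversal a ![u, w]) :
    Transversal a ![w, u] := by
  rw [transversal_two] at h ⊢
  intro α β γ h0 h1
  obtain ⟨h2, h3, h4⟩ := h α γ β h0 (by rw [← h1]; abel)
  exact ⟨h2, h4, h3⟩

lemma Transversal.left {a : ι → V} {u w : V} (h : Transversal a ![u, w]) :
    Transversal a ![u] := by
  rw [transversal_one]
  rw [transversal_two] at h
  intro α β h0 h1
  obtain ⟨h2, h3, -⟩ := h α β 0 h0 (by simpa using h1)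
  exact ⟨h2, h3⟩

lemma Transversal.points {m : ℕ} {a : ι → V} {x : Fin m → V} (h : Transversal a x) :
    Transversal a ![] := by
  intro α β h0 h1
  exact ⟨(h α 0 h0 (by simpa using h1)).1, Subsingleton.elim _ _⟩

lemma Transversal.comp_perm {m : ℕ} {a : ι → V} {x : Fin m → V} (h : Transversal a x)
    (σ : Equiv.Perm ι) : Transversal (a ∘ σ) x := by
  intro α β h0 h1
  have := h (α ∘ σ.symm) β (by rw [← h0]; exact Equiv.sum_comp σ.symm α)
    (by rw [← h1, ← Equiv.sum_comp σ]; simp)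
  refine ⟨?_, this.2⟩
  ext i
  simpa using congrFun this.1 (σ i)

lemma Transversal.sub_right {a : ι → V} {u w : V} (h : Transversal a ![u, w]) :
    Transversal a ![u, w - u] := by
  rw [transversal_two] at h ⊢
  intro α β γ h0 h1
  obtain ⟨h2, h3, h4⟩ := h α (β - γ) γ h0 (by rw [← h1]; module)
  exact ⟨h2, by linarith, h4⟩

variable [DecidableEq ι]

lemma sum_smul_add_single (a : ι → V) (i : ι) (u : V) (α : ι → ℝ) :
    ∑ j, α j • (a + Pi.single i u : ι → V) j = ∑ j, α j • a j + α i • u := by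
  simp only [Pi.add_apply, smul_add, Finset.sum_add_distrib]
  congr 1
  rw [Finset.sum_eq_single i] <;> simp +contextual

lemma Transversal.shift_left {a : ι → V} {u w : V} (h : Transversal a ![u, w]) (i : ι) :
    Transversal (a + Pi.single i u : ι → V) ![u, w] := by
  rw [transversal_two] at h ⊢
  intro α β γ h0 h1
  rw [sum_smul_add_single] at h1
  obtain ⟨h2, h3, h4⟩ := h α (α i + β) γ h0 (by rw [← h1]; module)
  exact ⟨h2, by simpa [h2] using h3, h4⟩

lemma Transversal.shift_right {a : ι → V} {u w : V} (h : Transversal a ![u, w]) (i : ι) :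
    Transversal (a + Pi.single i w) ![u, w] :=
  (h.swap.shift_left i).swap

end Transversal

/-! ### Generic displacements preserve transversality -/

section Generic

lemma ae_add_left {V : Type*} [AddGroup V] [MeasurableSpace V] [MeasurableAdd V] {μ : Measure V}
    [μ.IsAddLeftInvariant] {p : V → Prop} (h : ∀ᵐ v ∂μ, p v) (q : V) : ∀ᵐ v ∂μ, p (q + v) :=
  (measurePreserving_add_left μ q).quasiMeasurePreserving.ae h

lemma ae_sub_left {V : Type*} [AddGroup V] [MeasurableSpace V] [MeasurableAdd V] [MeasurableNeg V]
    {μ : Measure V} [μ.IsAddLeftInvariant] [μ.IsNegInvariant] {p : V → Prop} (h : ∀ᵐ v ∂μ, p v)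
    (q : V) : ∀ᵐ v ∂μ, p (q - v) :=
  (Measure.measurePreserving_sub_left μ q).quasiMeasurePreserving.ae h

variable {V : Type*} [NormedAddCommGroup V] [NormedSpace ℝ V] [FiniteDimensional ℝ V]
  [MeasurableSpace V] [BorelSpace V] (μ : Measure V) [μ.IsAddHaarMeasure]
  {ι : Type*} [Fintype ι]

/-- A generic vector is transversal, as long as the dimension allows it. -/
lemma Transversal.ae_cons {m : ℕ} [Nonempty ι] {a : ι → V} {x : Fin m → V} (h : Transversal a x)
    (hd : m + Fintype.card ι ≤ Module.finrank ℝ V) :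
    ∀ᵐ v ∂μ, Transversal a (Matrix.vecCons v x) := by
  classical
  let i₀ : ι := Classical.arbitrary ι
  -- The bad vectors form the span of the edges at `i₀` and of `x`, of dimension at most `card ι - 1
  -- + m`.
  let f : ({i // i ≠ i₀} → ℝ) × (Fin m → ℝ) →ₗ[ℝ] V :=
    LinearMap.coprod (Fintype.linearCombination ℝ fun i : {i // i ≠ i₀} => a i - a i₀)
      (Fintype.linearCombination ℝ x)
  have hf : LinearMap.range f ≠ ⊤ := by
    intro hf
    have h1 := LinearMap.finrank_range_le f
    rw [hf, finrank_top, Module.finrank_prod, Module.finrank_pi, Module.finrank_pi,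
      Fintype.card_fin, Fintype.card_subtype_compl, Fintype.card_subtype_eq] at h1
    have := Fintype.card_pos (α := ι)
    omega
  filter_upwards [show ∀ᵐ v ∂μ, v ∉ LinearMap.range f from
    measure_eq_zero_iff_ae_notMem.1 (Measure.addHaar_submodule μ _ hf)] with v hv α β h0 h1
  have hβ : β 0 = 0 := by
    by_contra hβ
    refine hv ⟨(fun i => -(β 0)⁻¹ * α i, fun j => -(β 0)⁻¹ * β j.succ), ?_⟩
    rw [Fin.sum_univ_succ] at h1
    have h2 : ∑ i, α i • a i = ∑ i : {i // i ≠ i₀}, α i • (a i - a i₀) := by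
      have e1 : ∑ i, α i • a i = ∑ i, α i • (a i - a i₀) := by
        simp [smul_sub, Finset.sum_sub_distrib, ← Finset.sum_smul, h0]
      rw [e1, Fintype.sum_eq_add_sum_subtype_ne _ i₀]
      simp
    simp only [Matrix.cons_val_zero, Matrix.cons_val_succ, h2] at h1
    simp only [f, LinearMap.coprod_apply, Fintype.linearCombination_apply, mul_smul,
      ← Finset.smul_sum]
    rw [← smul_add, neg_smul, neg_eq_iff_eq_neg, inv_smul_eq_iff₀ hβ, smul_neg,
      eq_neg_iff_add_eq_zero, ← h1]
    abel
  obtain ⟨h2, h3⟩ := h α (fun j => β j.succ) h0 (by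
    rw [Fin.sum_univ_succ] at h1
    simpa [hβ] using h1)
  refine ⟨h2, ?_⟩
  ext j
  refine Fin.cases hβ (fun j => congrFun h3 j) j

variable [DecidableEq ι]

/-- Transversality persists under a generic change of one of the points. -/
lemma Transversal.ae_add_single {m : ℕ} {a : ι → V} {x : Fin m → V} (h : Transversal a x)
    (i : ι) : ∀ᵐ (v : V) ∂μ, Transversal (a + Pi.single i v : ι → V) x := by
  -- A relation for the moved points in which vertex `i` takes part can be scaled to `α i = -1`; it
  -- then exhibits `v` as a point of `A`. Transversality of `a` and `x` says that `0 ∉ A`, so `A` is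
  -- proper.
  let A : AffineSubspace ℝ V :=
    { carrier := {v | ∃ (α : ι → ℝ) (β : Fin m → ℝ), ∑ j, α j = 0 ∧ α i = -1 ∧
        v = ∑ j, α j • a j + ∑ j, β j • x j}
      smul_vsub_vadd_mem' := by
        rintro c _ _ _ ⟨α₁, β₁, h₁, h₁', rfl⟩ ⟨α₂, β₂, h₂, h₂', rfl⟩ ⟨α₃, β₃, h₃, h₃', rfl⟩
        refine ⟨c • (α₁ - α₂) + α₃, c • (β₁ - β₂) + β₃, ?_, ?_, ?_⟩
        · simp [Finset.sum_add_distrib, ← Finset.mul_sum, Finset.sum_sub_distrib, h₁, h₂, h₃]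
        · simp [h₁', h₂', h₃']
        · simp only [Pi.add_apply, Pi.smul_apply, Pi.sub_apply, add_smul, smul_assoc, sub_smul,
            Finset.sum_add_distrib, ← Finset.smul_sum, Finset.sum_sub_distrib, vsub_eq_sub,
            vadd_eq_add]
          module }
  have h0 : (0 : V) ∉ A := by
    rintro ⟨α, β, h1, h2, h3⟩
    have := (h α β h1 h3.symm).1
    simp [this] at h2
  have hA : A ≠ ⊤ := by
    rintro hA
    simp [hA] at h0
  filter_upwards [show ∀ᵐ v ∂μ, v ∉ A from
    measure_eq_zero_iff_ae_notMem.1 (Measure.addHaar_affineSubspace μ A hA)]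
    with v hv α β h1 h2
  rw [sum_smul_add_single] at h2
  have hα : α i = 0 := by
    by_contra hα
    refine hv ⟨fun j => -(α i)⁻¹ * α j, fun j => -(α i)⁻¹ * β j, ?_, ?_, ?_⟩
    · rw [← Finset.mul_sum, h1, mul_zero]
    · field_simp
    · simp only [mul_smul, ← Finset.smul_sum]
      rw [← smul_add, eq_comm, neg_smul, neg_eq_iff_eq_neg, inv_smul_eq_iff₀ hα]
      rw [smul_neg, eq_neg_iff_add_eq_zero, ← h2]
      abel
  exact h α β h1 (by simpa [hα] using h2)

end Generic

/-! ### Jumps of a sliding function -/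

section Sliding

variable {V : Type*} [NormedAddCommGroup V] [NormedSpace ℝ V] {ι : Type*} [Fintype ι]
  [DecidableEq ι] {Q : Type*} [AddCommGroup Q] [Module ℝ Q]

/-- A function `g` of a simplex and of a force on it, linear in the force, *slides* if it does not
depend on the order of the vertices, and if a vertex may be moved along the force. -/
structure Sliding (g : (ι → V) → V →ₗ[ℝ] Q) : Prop where
  comp_perm : ∀ (a : ι → V) (σ : Equiv.Perm ι), g (a ∘ σ) = g a
  slide : ∀ (a : ι → V) (i : ι) (F : V), Transversal a ![F] → g (a + Pi.single i F) F = g a F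

/-- The change of `g` under the translation of the vertex `i` by `u`. -/
def jump (g : (ι → V) → V →ₗ[ℝ] Q) (i : ι) (a : ι → V) (u : V) : V →ₗ[ℝ] Q :=
  g (a + Pi.single i u) - g a

omit [Fintype ι] in
lemma jump_apply (g : (ι → V) → V →ₗ[ℝ] Q) (i : ι) (a : ι → V) (u w : V) :
    jump g i a u w = g (a + Pi.single i u) w - g a w := rfl

omit [Fintype ι] in
lemma jump_add (g : (ι → V) → V →ₗ[ℝ] Q) (i : ι) (a : ι → V) (u v w : V) :
    jump g i a (u + v) w = jump g i a u w + jump g i (a + Pi.single i u) v w := by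
  simp only [jump_apply, Pi.single_add, ← add_assoc]
  abel

omit [Fintype ι] in
lemma jump_comm (g : (ι → V) → V →ₗ[ℝ] Q) (i j : ι) (a : ι → V) (u v w : V) :
    jump g i (a + Pi.single j v) u w - jump g i a u w =
      jump g j (a + Pi.single i u) v w - jump g j a v w := by
  simp only [jump_apply, add_right_comm a (Pi.single i u) (Pi.single j v)]
  abel

omit [NormedSpace ℝ V] [Fintype ι] in
lemma add_single_comp_swap (a : ι → V) (i j : ι) (v : V) :
    (a + Pi.single i v) ∘ Equiv.swap i j = a ∘ Equiv.swap i j + Pi.single j v := by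
  ext k
  simp only [Function.comp_apply, Pi.add_apply]
  congr 1
  simp [Pi.single_apply, Equiv.swap_apply_eq_iff]

omit [NormedSpace ℝ V] [Fintype ι] in
lemma comp_swap_eq (a : ι → V) {i j : ι} (hij : i ≠ j) :
    a ∘ Equiv.swap i j = a + Pi.single i (a j - a i) - Pi.single j (a j - a i) := by
  ext k
  rcases eq_or_ne k i with rfl | hi
  · simp [hij]
  rcases eq_or_ne k j with rfl | hj
  · simp [hij.symm]
  · simp [Equiv.swap_apply_of_ne_of_ne hi hj, hi, hj]

variable {g : (ι → V) → V →ₗ[ℝ] Q}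

lemma Sliding.jump_comp_swap (hg : Sliding g) (i j : ι) (a : ι → V) (u w : V) :
    jump g j (a ∘ Equiv.swap i j) u w = jump g i a u w := by
  rw [jump_apply, jump_apply, ← add_single_comp_swap, hg.comp_perm, hg.comp_perm]

/-- Vertex `i` can go from `a i + u` to `a i + w` by sliding along `w - u`. Expanding this by
linearity and removing the diagonal terms by sliding along `u` and along `w` leaves the
antisymmetry. -/
lemma Sliding.jump_antisymm (hg : Sliding g) (i : ι) {a : ι → V} {u w : V}
    (h : Transversal a ![u, w]) : jump g i a u w = -jump g i a w u := by
  have h1 := hg.slide a i u h.left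
  have h2 := hg.slide a i w h.swap.left
  have h3 := hg.slide (a + Pi.single i u) i (w - u) (h.shift_left i).sub_right.swap.left
  rw [add_assoc, ← Pi.single_add, add_sub_cancel, map_sub, map_sub, h2] at h3
  rw [jump_apply, jump_apply, ← h1]
  linear_combination (norm := module) -h3

/-- The transposition of `u` and `v` is a product of transpositions of a displacement with the
force, each giving a sign by `jump_antisymm`; `jump_comm` exchanges the roles of `i` and `j` in
between. Three signs occur. -/
lemma Sliding.second_jump_antisymm (hg : Sliding g) {i j : ι} {a : ι → V} {u v w : V}
    (h1 : Transversal a ![u, w]) (h2 : Transversal a ![v, u]) (h3 : Transversal a ![w, v])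
    (h4 : Transversal (a + Pi.single j v) ![u, w]) (h5 : Transversal (a + Pi.single i w) ![v, u])
    (h6 : Transversal (a + Pi.single j u) ![w, v]) :
    jump g i (a + Pi.single j v) u w - jump g i a u w =
      -(jump g i (a + Pi.single j u) v w - jump g i a v w) := by
  rw [hg.jump_antisymm i h4, hg.jump_antisymm i h1, neg_sub_neg, ← neg_sub, jump_comm,
    hg.jump_antisymm j h5, hg.jump_antisymm j h2, neg_sub_neg, ← neg_sub (jump g j _ u v),
    jump_comm, hg.jump_antisymm i h6, hg.jump_antisymm i h3]
  abel

variable [FiniteDimensional ℝ V] [MeasurableSpace V] [BorelSpace V]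
  (μ : Measure V) [μ.IsAddHaarMeasure]

omit [NormedSpace ℝ V] [FiniteDimensional ℝ V] in
/-- If `P` is stable under generic changes of one point and `f` is invariant under them, then `f`
is constant on `P`. -/
lemma eq_of_ae_add_single {Q : Type*} (P : (ι → V) → Prop) (f : (ι → V) → Q)
    (h : ∀ a, P a → ∀ i, ∀ᵐ (v : V) ∂μ, P (a + Pi.single i v) ∧ f (a + Pi.single i v) = f a)
    {a b : ι → V} (ha : P a) (hb : P b) : f a = f b := by
  suffices H : ∀ (S : Finset ι) (a b : ι → V), P a → P b → (∀ i, i ∉ S → a i = b i) → f a = f b from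
    H Finset.univ a b ha hb (by simp)
  intro S
  induction S using Finset.induction_on with
  | empty =>
    intro a b _ _ hab
    rw [show a = b from funext fun i => hab i (by simp)]
  | insert j S _ IH =>
    intro a b ha hb hab
    -- The new common position of vertex `j` is chosen generic for `a` and `b` simultaneously.
    obtain ⟨v, ⟨h1, h2⟩, h3, h4⟩ :=
      ((h a ha j).and (ae_add_left (h b hb j) (a j - b j))).exists
    rw [← h2, ← h4]
    refine IH _ _ h1 h3 fun i hi => ?_
    rcases eq_or_ne i j with rfl | hij
    · simp only [Pi.add_apply, Pi.single_eq_same]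
      abel
    · simp [hij, hab i (by simp [hij, hi])]

-- By antisymmetry the jump is additive in the displacement, for generic `v`. Comparing this with
-- the move by `v` followed by the move by `u` gives the claim.
include μ in
lemma Sliding.ae_jump_eq_self (hg : Sliding g) [Nonempty ι]
    (hd : Fintype.card ι + 1 ≤ Module.finrank ℝ V) (i : ι) {a : ι → V} {u w : V}
    (h : Transversal a ![u, w]) :
    ∀ᵐ (v : V) ∂μ, jump g i (a + Pi.single i v) u w = jump g i a u w := by
  have h1 := h.swap.left.ae_cons μ (by omega)
  filter_upwards [h1, ae_add_left h1 u] with v h2 h3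
  have h4 := jump_add g i a v u w
  rw [add_comm v u, hg.jump_antisymm i h3, map_add, hg.jump_antisymm i h2] at h4
  rw [hg.jump_antisymm i h]
  linear_combination (norm := module) -h4

-- The second difference `D` changes sign when `u` and `v` are exchanged. Exchanging them also
-- amounts to swapping vertices `i` and `j`, which does not alter `D` because `D` is independent of
-- their positions. Hence `2 D = 0`.
include μ in
lemma Sliding.ae_jump_eq_of_ne (hg : Sliding g) [Nonempty ι]
    (hd : Fintype.card ι + 1 ≤ Module.finrank ℝ V) {i j : ι} (hij : i ≠ j) {a : ι → V} {u w : V}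
    (h : Transversal a ![u, w]) :
    ∀ᵐ (v : V) ∂μ, jump g i (a + Pi.single j v) u w = jump g i a u w := by
  have ae1 {b : ι → V} {w : V} (h : Transversal b ![w]) : ∀ᵐ (v : V) ∂μ, Transversal b ![v, w] :=
    h.ae_cons μ (by omega)
  set b := a ∘ Equiv.swap i j with hb
  have hbT : Transversal b ![u, w] := h.comp_perm _
  filter_upwards [ae1 h.left, ae1 h.swap.left, h.ae_add_single μ j, ae1 (h.shift_right i).left,
    ae1 (h.shift_left j).swap.left, ae1 (h.shift_left i).swap.left, ae1 hbT.swap.left,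
    ae1 (hbT.shift_left i).swap.left, hbT.ae_add_single μ j] with v t1 t2 t3 t4 t5 t6 t7 t8 t9
  -- the second difference `D` is antisymmetric in `u`, `v`
  have key := hg.second_jump_antisymm h t1 t2.swap t3 t4 t5.swap
  have hs : jump g i (a + Pi.single j u) v w - jump g i a v w =
      jump g i (b + Pi.single j v) u w - jump g i b u w := by
    have e := hg.jump_comp_swap j i (a + Pi.single i v) u w
    rw [Equiv.swap_comm, add_single_comp_swap] at e
    have e' := hg.jump_comp_swap j i a u w
    rw [Equiv.swap_comm] at e'
    rw [jump_comm, hb, e, e']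
  -- and it does not depend on the base points
  let D (c : ι → V) : Q := jump g i (c + Pi.single j v) u w - jump g i c u w
  have hD1 {c : ι → V} (h1 : Transversal c ![u, w])
      (h2 : Transversal (c + Pi.single j v) ![u, w]) :
      ∀ᵐ (x : V) ∂μ, D (c + Pi.single i x) = D c := by
    filter_upwards [hg.ae_jump_eq_self μ hd i h1, hg.ae_jump_eq_self μ hd i h2] with x h3 h4
    simp only [D]
    rw [h3, add_right_comm, h4]
  have hD2 {c : ι → V} (h1 : Transversal c ![v, w])
      (h2 : Transversal (c + Pi.single i u) ![v, w]) :
      ∀ᵐ (x : V) ∂μ, D (c + Pi.single j x) = D c := by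
    filter_upwards [hg.ae_jump_eq_self μ hd j h1, hg.ae_jump_eq_self μ hd j h2] with x h3 h4
    simp only [D]
    rw [jump_comm g i j (c + _), jump_comm g i j c, h3, add_right_comm, h4]
  have hDab : D b = D a := by
    -- Since `b` is `a` with vertex `i` moved by `z` and vertex `j` by `-z`, both reach a common
    -- configuration: `a` by moving by `x`, `y`, and `b` by `-z + x`, `z + y`.
    let z := a j - a i
    obtain ⟨x, x1, x2, x3, x4, x5, x6⟩ := ((hD1 h t3).and <|
      (ae_add_left (hD1 hbT t9) (-z)).and <| (t2.ae_add_single μ i).and <|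
      (t6.ae_add_single μ i).and <| (ae_add_left (t7.ae_add_single μ i) (-z)).and
      (ae_add_left (t8.ae_add_single μ i) (-z))).exists
    rw [add_right_comm] at x4 x6
    obtain ⟨y, y1, y2⟩ := ((hD2 x3 x4).and (ae_add_left (hD2 x5 x6) z)).exists
    rw [← x1, ← x2, ← y1, ← y2]
    congr 1
    rw [hb, comp_swap_eq a hij]
    simp only [Pi.single_add, Pi.single_neg]
    abel
  change D a = -_ at key
  rw [hs, show jump g i (b + Pi.single j v) u w - jump g i b u w = D b from rfl, hDab] at key
  have h2D : (2 : ℝ) • D a = 0 := by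
    rw [two_smul]
    nth_rewrite 1 [key]
    exact neg_add_cancel _
  exact sub_eq_zero.1 ((smul_eq_zero.1 h2D).resolve_left two_ne_zero)

include μ in
lemma Sliding.jump_eq_of_transversal (hg : Sliding g) [Nonempty ι]
    (hd : Fintype.card ι + 1 ≤ Module.finrank ℝ V) (i j : ι) {a b : ι → V} {u w : V}
    (ha : Transversal a ![u, w]) (hb : Transversal b ![u, w]) :
    jump g i a u w = jump g j b u w := by
  rw [← hg.jump_comp_swap i j]
  refine eq_of_ae_add_single μ (fun a => Transversal a ![u, w]) (fun a => jump g j a u w) ?_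
    (ha.comp_perm _) hb
  intro a ha k
  refine (ha.ae_add_single μ k).and ?_
  rcases eq_or_ne j k with rfl | hjk
  · exact hg.ae_jump_eq_self μ hd j ha
  · exact hg.ae_jump_eq_of_ne μ hd hjk ha

include μ in
lemma Sliding.jump_eq (hg : Sliding g) [Nonempty ι]
    (hd : Fintype.card ι + 1 ≤ Module.finrank ℝ V) (i j : ι) {a b : ι → V} {u : V}
    (ha : Transversal a ![u]) (hb : Transversal b ![u]) :
    jump g i a u = jump g j b u := by
  ext w
  have ha' := ha.ae_cons μ (by omega)
  have hb' := hb.ae_cons μ (by omega)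
  -- An arbitrary force `w` is the sum of two generic ones, `v` and `w - v`.
  obtain ⟨v, h1, h2, h3, h4⟩ := (ha'.and <| hb'.and <| (ae_sub_left ha' w).and
    (ae_sub_left hb' w)).exists
  rw [show w = v + (w - v) by abel, map_add, map_add,
    hg.jump_eq_of_transversal μ hd i j h1.swap h2.swap,
    hg.jump_eq_of_transversal μ hd i j h3.swap h4.swap]

end Sliding

/-- Linearly independent vectors are transversal to some family of points, as long as the dimension
allows it. -/
lemma exists_transversal {V : Type*} [AddCommGroup V] [Module ℝ V] [FiniteDimensional ℝ V]
    {ι : Type*} [Fintype ι] [Nonempty ι] {m : ℕ} {x : Fin m → V} (hx : LinearIndependent ℝ x)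
    (hd : m + Fintype.card ι ≤ Module.finrank ℝ V + 1) : ∃ a : ι → V, Transversal a x := by
  classical
  let i₀ : ι := Classical.arbitrary ι
  let b := Module.Basis.sumExtend hx
  have hfin : Finite (Fin m ⊕ Module.Basis.sumExtendIndex hx) := Module.Finite.finite_basis b
  have : Fintype (Module.Basis.sumExtendIndex hx) :=
    have := Finite.sum_right (Fin m) (β := Module.Basis.sumExtendIndex hx)
    Fintype.ofFinite _
  have hcard := Module.finrank_eq_card_basis b
  rw [Fintype.card_sum, Fintype.card_fin] at hcard
  obtain ⟨f⟩ : Nonempty ({i // i ≠ i₀} ↪ Module.Basis.sumExtendIndex hx) := by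
    rw [Function.Embedding.nonempty_iff_card_le, Fintype.card_subtype_compl,
      Fintype.card_subtype_eq]
    omega
  have hli := b.linearIndependent.comp _
    (Sum.map_injective.2 ⟨Function.injective_id (α := Fin m), f.injective⟩)
  rw [Fintype.linearIndependent_iff] at hli
  -- Vertex `i₀` is the origin; the others are basis vectors complementing `x`.
  refine ⟨fun i => if h : i ≠ i₀ then b (Sum.inr (f ⟨i, h⟩)) else 0, fun α β h0 h1 => ?_⟩
  have hb (j : Fin m) : b (Sum.inl j) = x j := by
    simp only [b, Module.Basis.sumExtend, Module.Basis.reindex_apply, Module.Basis.extend_apply_self]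
    simp
    rfl
  rw [Fintype.sum_eq_add_sum_subtype_ne _ i₀] at h0 h1
  have := hli (Sum.elim β fun i => α i) (by
    rw [← h1, Fintype.sum_sum_type, add_comm]
    congr 1
    · beta_reduce
      rw [dif_neg (not_not_intro rfl), smul_zero, zero_add]
      refine Finset.sum_congr rfl fun i _ => ?_
      rw [dif_pos i.2]
      simp
    · simp [hb])
  have hα (i : {i // i ≠ i₀}) : α i = 0 := this (Sum.inr i)
  refine ⟨?_, funext fun j => this (Sum.inl j)⟩
  ext i
  by_cases hi : i = i₀
  · simpa [hi, hα] using h0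
  · exact hα ⟨i, hi⟩

/-! ### The alternating form attached to a sliding function -/

section Sliding

variable {V : Type*} [NormedAddCommGroup V] [NormedSpace ℝ V] {ι : Type*} [Fintype ι]
  [DecidableEq ι] {Q : Type*} [AddCommGroup Q] [Module ℝ Q] {g : (ι → V) → V →ₗ[ℝ] Q}
  [FiniteDimensional ℝ V] [Nonempty ι]

lemma Sliding.exists_jump_eq (hg : Sliding g) (hd : Fintype.card ι + 1 ≤ Module.finrank ℝ V) :
    ∃ γ : V →ₗ[ℝ] V →ₗ[ℝ] Q, γ.IsAlt ∧
      ∀ (i : ι) (a : ι → V) (u : V), Transversal a ![u] → jump g i a u = γ u := by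
  classical
  borelize V
  let μ : Measure V := Measure.addHaar
  -- In this dimension the default value 0 is taken only at `u = 0`.
  let L (u : V) : V →ₗ[ℝ] Q :=
    if h : ∃ a : ι → V, Transversal a ![u] then jump g (Classical.arbitrary ι) h.choose u else 0
  have hL {i : ι} {a : ι → V} {u : V} (h : Transversal a ![u]) : jump g i a u = L u := by
    have h' : ∃ a : ι → V, Transversal a ![u] := ⟨a, h⟩
    simp only [L, dif_pos h']
    exact hg.jump_eq μ hd _ _ h h'.choose_spec
  have hself (u : V) : L u u = 0 := by
    by_cases h : ∃ a : ι → V, Transversal a ![u]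
    · obtain ⟨a, ha⟩ := h
      rw [← hL (i := Classical.arbitrary ι) ha, jump_apply, hg.slide _ _ _ ha, sub_self]
    · simp [L, h]
  have hzero : L 0 = 0 := by
    refine dif_neg ?_
    rintro ⟨a, ha⟩
    have := (transversal_one.1 ha 0 1 (by simp) (by simp)).2
    exact one_ne_zero this
  -- Linearity of `L` in its index will follow from linearity in the force through this
  -- antisymmetry.
  have hanti (u w : V) : L u w = -L w u := by
    by_cases hli : LinearIndependent ℝ ![u, w]
    · obtain ⟨a, ha⟩ := exists_transversal (ι := ι) hli (by omega)
      have i : ι := Classical.arbitrary ι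
      rw [← hL (i := i) ha.left, ← hL (i := i) ha.swap.left, hg.jump_antisymm i ha]
    · rcases eq_or_ne u 0 with rfl | hu
      · simp [hzero]
      rw [LinearIndependent.pair_iff' hu] at hli
      push Not at hli
      obtain ⟨c, rfl⟩ := hli
      rcases eq_or_ne c 0 with rfl | hc
      · simp [hzero]
      · have h := hself (c • u)
        rw [map_smul] at h
        rw [map_smul, hself, (smul_eq_zero.1 h).resolve_left hc]
        simp
  refine ⟨LinearMap.mk₂ ℝ (fun u w => L u w) (fun u v w => ?_) (fun c u w => ?_)
    (fun u v w => map_add _ _ _) (fun c u w => map_smul _ _ _), fun u => hself u,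
    fun i a u h => ?_⟩
  · rw [hanti, map_add, hanti u, hanti v]
    abel
  · rw [hanti, map_smul, hanti u, smul_neg]
  · rw [hL h]
    rfl

/-- A sliding function depends only on the force and on its torque about the barycenter. -/
theorem Sliding.exists_eq (hg : Sliding g) (hd : Fintype.card ι + 1 ≤ Module.finrank ℝ V) :
    ∃ (δ : V →ₗ[ℝ] Q) (γ : V →ₗ[ℝ] V →ₗ[ℝ] Q), γ.IsAlt ∧
      ∀ a : ι → V, Transversal a ![] → ∀ w, g a w = δ w + γ (∑ i, a i) w := by
  borelize V
  let μ : Measure V := Measure.addHaar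
  obtain ⟨γ, hγ, h⟩ := hg.exists_jump_eq hd
  obtain ⟨b, hb⟩ := exists_transversal (V := V) (ι := ι) (x := ![])
    linearIndependent_empty_type (by omega)
  refine ⟨g b - γ (∑ i, b i), γ, hγ, fun a ha w => ?_⟩
  have key : g a - γ (∑ i, a i) = g b - γ (∑ i, b i) := by
    refine eq_of_ae_add_single μ (fun a => Transversal a ![]) (fun a => g a - γ (∑ i, a i)) ?_ ha hb
    intro a ha i
    filter_upwards [ha.ae_add_single μ i, ha.ae_cons μ (by omega)] with v h1 h2
    refine ⟨h1, ?_⟩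
    have h3 := h i a v h2
    rw [jump, sub_eq_iff_eq_add] at h3
    simp only [Pi.add_apply, Finset.sum_add_distrib, map_add, h3, Finset.sum_pi_single',
      Finset.mem_univ, if_true]
    abel
  rw [← key]
  simp

end Sliding

/-! ### Areas, heights and beams of rank one -/

/-- Expansion of a Gram determinant along the vector `w p`, of which `z` is the component orthogonal
to the other vectors. -/
lemma det_gram_eq_mul {E : Type*} [NormedAddCommGroup E] [InnerProductSpace ℝ E] {d : ℕ}
    (w : Fin (d + 1) → E) (p : Fin (d + 1)) {y z : E} (hw : w p = y + z)
    (hy : y ∈ Submodule.span ℝ (w '' {p}ᶜ)) (hz : ∀ i, i ≠ p → ⟪z, w i⟫ = 0) :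
    (Matrix.gram ℝ w).det =
      ⟪z, w p⟫ * (Matrix.gram ℝ fun i => w (p.succAbove i)).det := by
  let R (x : E) : ℝ := ((Matrix.gram ℝ w).updateRow p fun j => ⟪x, w j⟫).det
  have hR (x x' : E) : R (x + x') = R x + R x' := by
    simp only [R, ← Matrix.det_updateRow_add, Pi.add_def, inner_add_left]
  have hR' (c : ℝ) (x : E) : R (c • x) = c * R x := by
    simp only [R, ← Matrix.det_updateRow_smul, Pi.smul_def, real_inner_smul_left, smul_eq_mul]
  have h0 : R y = 0 := by
    clear hw
    induction hy using Submodule.span_induction with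
    | mem x hx =>
      obtain ⟨i, hi, rfl⟩ := hx
      exact Matrix.det_updateRow_eq_zero (M := Matrix.gram ℝ w) (i := i) (j := p) hi
    | zero => simpa using hR' 0 0
    | add x x' _ _ h h' => rw [hR, h, h', add_zero]
    | smul c x _ h => rw [hR', h, mul_zero]
  have h1 : (Matrix.gram ℝ w).det = R (w p) := by
    simp only [R]
    congr 1
    exact (Matrix.updateRow_eq_self (Matrix.gram ℝ w) p).symm
  rw [h1, hw, hR, h0, zero_add, ← hw]
  simp only [R]
  rw [Matrix.det_succ_row _ p, Finset.sum_eq_single p]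
  · rw [← two_mul, pow_mul]
    simp only [even_two, Even.neg_pow, one_pow, one_mul, Matrix.updateRow_self]
    congr 2
    ext i j
    simp [Matrix.gram]
  · intro j _ hj
    simp [hz j hj]
  · simp

variable {n d : ℕ}

lemma area_pos (s : Affine.Simplex ℝ (EuclideanSpace ℝ (Fin n)) d) : 0 < area s := by
  refine div_pos (Real.sqrt_pos.2 ?_) (by positivity)
  refine (Matrix.posDef_gram_of_linearIndependent ?_).det_pos
  have h := (affineIndependent_iff_linearIndependent_vsub ℝ _ 0).1 s.independent
  exact h.comp (fun j : Fin d => (⟨j.succ, Fin.succ_ne_zero j⟩ : {i : Fin (d + 1) // i ≠ 0}))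
    (fun i j hij => Fin.succ_injective _ (Subtype.ext_iff.1 hij))

/-- Base times height is the same for all facets containing the vertex `0`. -/
lemma area_faceOpposite_mul_height (s : Affine.Simplex ℝ (EuclideanSpace ℝ (Fin n)) (d + 1))
    (p : Fin (d + 1)) :
    area (s.faceOpposite p.succ) * s.height p.succ =
      √(Matrix.gram ℝ fun j : Fin (d + 1) => s.points j.succ - s.points 0).det / d.factorial := by
  have h := det_gram_eq_mul (fun j : Fin (d + 1) => s.points j.succ - s.points 0) p
    (y := s.altitudeFoot p.succ - s.points 0) (z := s.points p.succ - s.altitudeFoot p.succ)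
    (by abel) ?_ ?_
  · have h1 := s.inner_vsub_vsub_altitudeFoot_eq_height_sq (i := p.succ) (j := 0)
      (Fin.succ_ne_zero p)
    simp only [vsub_eq_sub] at h1
    rw [h, real_inner_comm, h1, Real.sqrt_mul (sq_nonneg _), Real.sqrt_sq (s.height_pos _).le,
      area, mul_comm (s.height _), div_mul_eq_mul_div]
    congr 4
    simp only [Affine.Simplex.faceOpposite_point_eq_point_succAbove]
    refine congrArg (Matrix.gram ℝ) (funext fun j : Fin d => ?_)
    exact congrArg₂ (fun a b => s.points a - s.points b) (Fin.succ_succAbove_succ p j)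
      (Fin.succ_succAbove_zero p)
  · have h1 := vsub_mem_vectorSpan_of_mem_affineSpan_of_mem_affineSpan
      (s.altitudeFoot_mem_affineSpan_image_compl p.succ)
      (s.mem_affineSpan_image_iff.2 (show (0 : Fin (d + 2)) ∈ ({p.succ}ᶜ : Set _) from
        (Fin.succ_ne_zero p).symm))
    rw [vectorSpan_eq_span_vsub_set_right ℝ (p := s.points 0)
      (Set.mem_image_of_mem _ (show (0 : Fin (d + 2)) ∈ ({p.succ}ᶜ : Set _) from
        (Fin.succ_ne_zero p).symm))] at h1
    refine Submodule.span_le.2 ?_ h1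
    rintro _ ⟨_, ⟨i, hi, rfl⟩, rfl⟩
    refine Fin.cases ?_ (fun i hi => ?_) i hi
    · simp
    · refine Submodule.subset_span ⟨i, ?_, rfl⟩
      simpa using hi
  · intro i hi
    have h1 := s.inner_vsub_altitudeFoot_vsub_altitudeFoot_eq_zero (i := p.succ) (j := i.succ)
      (by simpa using hi.symm)
    have h2 := s.inner_vsub_altitudeFoot_vsub_altitudeFoot_eq_zero (i := p.succ) (j := 0)
      (Fin.succ_ne_zero p)
    simp only [vsub_eq_sub] at h1 h2
    rw [real_inner_comm, ← sub_sub_sub_cancel_right _ _ (s.altitudeFoot p.succ), inner_sub_left,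
      h1, h2, sub_zero]

/-- `area` is computed from edges at the vertex of index 0, so facets containing vertex 0 of `s`
share a base point with it. This explains the restriction on `p`, `q`; for `d = 0` both heights are
the length of the segment. -/
lemma area_faceOpposite_mul_height_eq
    (s : Affine.Simplex ℝ (EuclideanSpace ℝ (Fin n)) (d + 1)) {p q : Fin (d + 2)}
    (h : d = 0 ∨ p ≠ 0 ∧ q ≠ 0) :
    area (s.faceOpposite p) * s.height p = area (s.faceOpposite q) * s.height q := by
  rcases h with rfl | ⟨hp, hq⟩
  · simp only [Affine.Simplex.height_eq_dist]
    congr 1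
  · obtain ⟨p, rfl⟩ := Fin.exists_succ_eq.2 hp
    obtain ⟨q, rfl⟩ := Fin.exists_succ_eq.2 hq
    rw [area_faceOpposite_mul_height, area_faceOpposite_mul_height]

/-- The stressed simplex with stress `c e eᵀ`. -/
def rankOneStress {k : ℕ} (s : Affine.Simplex ℝ (EuclideanSpace ℝ (Fin n)) k) (c : ℝ)
    (e : EuclideanSpace ℝ (Fin n)) : StressedSimplex n k where
  simplex := s
  stress := c • Matrix.vecMulVec e e
  isSymm := by
    rw [Matrix.IsSymm, Matrix.transpose_smul, Matrix.transpose_vecMulVec]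

lemma toEuclideanLin_rankOneStress {k : ℕ}
    (s : Affine.Simplex ℝ (EuclideanSpace ℝ (Fin n)) k) (c : ℝ) (e v : EuclideanSpace ℝ (Fin n)) :
    Matrix.toEuclideanLin (rankOneStress s c e).stress v = (c * ⟪e, v⟫) • e := by
  ext i
  simp [rankOneStress, Matrix.vecMulVec_mulVec, PiLp.inner_apply, dotProduct, mul_comm]
  ring

lemma rankOneStress_isStructural {k : ℕ}
    (s : Affine.Simplex ℝ (EuclideanSpace ℝ (Fin n)) k) (c : ℝ) (p q : Fin (k + 1)) :
    (rankOneStress s c (s.points p - s.points q)).IsStructural := by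
  intro t v ht _ h
  rw [toEuclideanLin_rankOneStress] at h
  have hv : v = t⁻¹ • (c * ⟪s.points p - s.points q, v⟫) • (s.points p - s.points q) := by
    rw [h, inv_smul_smul₀ ht]
  rw [hv]
  refine Submodule.smul_mem _ _ (Submodule.smul_mem _ _ ?_)
  exact AffineSubspace.vsub_mem_direction (mem_affineSpan ℝ (Set.mem_range_self p))
    (mem_affineSpan ℝ (Set.mem_range_self q))

/-- The edge lies in every facet other than the two opposite its ends, so it is orthogonal to the
normal there. -/
lemma facetForce_rankOneStress_of_ne (s : Affine.Simplex ℝ (EuclideanSpace ℝ (Fin n)) (d + 1))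
    (c : ℝ) {p q i : Fin (d + 2)} (hp : i ≠ p) (hq : i ≠ q) :
    (rankOneStress s c (s.points p - s.points q)).facetForce i = 0 := by
  have h1 := s.inner_vsub_altitudeFoot_vsub_altitudeFoot_eq_zero hp
  have h2 := s.inner_vsub_altitudeFoot_vsub_altitudeFoot_eq_zero hq
  simp only [vsub_eq_sub] at h1 h2
  have h3 : ⟪s.points p - s.points q, outwardNormal s i⟫ = 0 := by
    rw [outwardNormal, real_inner_smul_right, ← neg_sub (s.points i), inner_neg_right,
      ← sub_sub_sub_cancel_right _ _ (s.altitudeFoot i), inner_sub_left, h1, h2]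
    simp
  rw [StressedSimplex.facetForce, toEuclideanLin_rankOneStress]
  change _ • (c * ⟪_, outwardNormal s i⟫) • _ = _
  rw [h3]
  simp

lemma inner_sub_outwardNormal (s : Affine.Simplex ℝ (EuclideanSpace ℝ (Fin n)) (d + 1))
    {p q : Fin (d + 2)} (h : p ≠ q) :
    ⟪s.points p - s.points q, outwardNormal s p⟫ = -s.height p := by
  have h1 := s.inner_vsub_vsub_altitudeFoot_eq_height_sq h
  have h2 := (s.height_pos p).ne'
  simp only [vsub_eq_sub] at h1
  rw [outwardNormal, real_inner_smul_right, ← neg_sub (s.points p) (s.altitudeFoot p),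
    inner_neg_right, h1]
  field_simp

lemma facetForce_rankOneStress_left (s : Affine.Simplex ℝ (EuclideanSpace ℝ (Fin n)) (d + 1))
    (c : ℝ) {p q : Fin (d + 2)} (h : p ≠ q) :
    (rankOneStress s c (s.points p - s.points q)).facetForce p =
      -(c * (area (s.faceOpposite p) * s.height p)) • (s.points p - s.points q) := by
  rw [StressedSimplex.facetForce, toEuclideanLin_rankOneStress]
  change area (s.faceOpposite p) • (c * ⟪_, outwardNormal s p⟫) • _ = _
  rw [inner_sub_outwardNormal s h, smul_smul]
  congr 1
  ring

lemma facetForce_rankOneStress_right (s : Affine.Simplex ℝ (EuclideanSpace ℝ (Fin n)) (d + 1))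
    (c : ℝ) {p q : Fin (d + 2)} (h : p ≠ q) :
    (rankOneStress s c (s.points p - s.points q)).facetForce q =
      (c * (area (s.faceOpposite q) * s.height q)) • (s.points p - s.points q) := by
  rw [StressedSimplex.facetForce, toEuclideanLin_rankOneStress]
  change area (s.faceOpposite q) • (c * ⟪_, outwardNormal s q⟫) • _ = _
  rw [← neg_sub (s.points q) (s.points p), inner_neg_left, inner_sub_outwardNormal s h.symm,
    smul_smul, neg_neg]
  congr 1
  ring

lemma transversal_iff_affineIndependent {V ι : Type*} [AddCommGroup V] [Module ℝ V] [Fintype ι]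
    {a : ι → V} : Transversal a ![] ↔ AffineIndependent ℝ a := by
  classical
  rw [affineIndependent_iff]
  constructor
  · intro h s α h0 h1 i hi
    have := (h (fun i => if i ∈ s then α i else 0) 0 (by simpa using h0) (by simpa using h1)).1
    simpa [hi] using congrFun this i
  · intro h α β h0 h1
    exact ⟨funext fun i => h Finset.univ α h0 (by simpa using h1) i (Finset.mem_univ i),
      Subsingleton.elim _ _⟩

lemma Transversal.snoc {V : Type*} [AddCommGroup V] [Module ℝ V] {d : ℕ} {a : Fin (d + 1) → V}
    {F : V} (h : Transversal a ![F]) (i : Fin (d + 1)) :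
    Transversal (Fin.snoc a (a i + F) : Fin (d + 2) → V) ![] := by
  rw [transversal_one] at h
  intro α β h0 h1
  rw [Fin.sum_univ_castSucc] at h0 h1
  simp only [Fin.snoc_castSucc, Fin.snoc_last, Finset.univ_eq_empty, Finset.sum_empty,
    add_zero] at h1
  obtain ⟨h2, h3⟩ := h ((fun j => α j.castSucc) + Pi.single i (α (Fin.last _))) (α (Fin.last _))
    (by simpa [Finset.sum_add_distrib] using h0) (by
      rw [← h1]
      simp [add_smul, Finset.sum_add_distrib, Pi.single_apply, add_assoc])
  refine ⟨?_, Subsingleton.elim _ _⟩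
  ext j
  refine Fin.lastCases h3 (fun j => ?_) j
  simpa [h3] using congrFun h2 j

/-! ### Force systems as pairs of vector measures -/

section VectorMeasures

variable {n : ℕ}

local notation "E" => EuclideanSpace ℝ (Fin n)

/-- The vector measure with constant density with respect to `μ`, linearly in the density. -/
def constDensity {α V : Type*} [MeasurableSpace α] [NormedAddCommGroup V] [NormedSpace ℝ V]
    (μ : Measure α) : V →ₗ[ℝ] VectorMeasure α V where
  toFun F := μ.withDensityᵥ fun _ => F
  map_add' F G := by
    by_cases h : IsFiniteMeasure μ
    · exact withDensityᵥ_add (integrable_const F) (integrable_const G)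
    -- A nonintegrable density gives the default measure 0, so linearity holds without knowing that
    -- simplices have finite area.
    · have h0 (F : V) : (μ.withDensityᵥ fun _ => F) = 0 := by
        rcases eq_or_ne F 0 with rfl | hF
        · exact withDensityᵥ_zero
        · refine dif_neg ?_
          rw [integrable_const_iff]
          tauto
      rw [h0, h0, h0, add_zero]
  map_smul' c F := withDensityᵥ_smul (fun _ => F) c

/-- The constant force `F` on a set `K`, as a pair of vector measures: with total force `F`, and
with density `F`. -/
def setForce (d : ℕ) (K : Set E) : E →ₗ[ℝ] VectorMeasure E E × VectorMeasure E E :=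
  (constDensity (ProbabilityTheory.cond μHE[d] K)).prod (constDensity (μHE[d].restrict K))

lemma setForce_apply {d : ℕ} (s : Affine.Simplex ℝ E d) (F : E) :
    setForce d (convexHull ℝ (Set.range s.points)) F = (uniformForce s F, densityForce s F) := by
  rw [Affine.Simplex.convexHull_eq_closedInterior]
  rfl

/-- The two vector measures of a force system. -/
def ForceSystem.measures {d l : ℕ} (S : ForceSystem n d l) :
    VectorMeasure E E × VectorMeasure E E :=
  (S.uniformMeasure, S.densityMeasure)

lemma ForceSystem.measures_eq_sum {d l : ℕ} (S : ForceSystem n d l) :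
    S.measures = ∑ i, setForce d (convexHull ℝ (Set.range (S.simplex i).points)) (S.force i) := by
  simp only [setForce_apply, measures, uniformMeasure, densityMeasure]
  rw [Prod.ext_iff, Prod.fst_sum, Prod.snd_sum]
  exact ⟨rfl, rfl⟩

/-- The stressed simplex with stress multiplied by `c`. -/
def StressedSimplex.scale {k : ℕ} (P : StressedSimplex n k) (c : ℝ) : StressedSimplex n k where
  simplex := P.simplex
  stress := c • P.stress
  isSymm := P.isSymm.smul c

lemma StressedSimplex.IsStructural.scale {k : ℕ} {P : StressedSimplex n k} (h : P.IsStructural)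
    (c : ℝ) : (P.scale c).IsStructural := by
  intro t v ht hv htv
  have htv' : c • Matrix.toEuclideanLin P.stress v = t • v := by
    rw [← htv]
    simp [StressedSimplex.scale]
  rcases eq_or_ne c 0 with rfl | hc
  · rw [zero_smul, eq_comm, smul_eq_zero] at htv'
    tauto
  · refine h (c⁻¹ * t) v (by positivity) hv ?_
    rw [mul_smul, ← htv', inv_smul_smul₀ hc]

variable {k : ℕ} [NeZero k]

lemma StressedSimplex.measures_beam_scale (P : StressedSimplex n k) (c : ℝ) :
    (P.scale c).beam.measures = c • P.beam.measures := by
  rw [ForceSystem.measures_eq_sum, ForceSystem.measures_eq_sum, Finset.smul_sum]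
  refine Finset.sum_congr rfl fun i _ => ?_
  rw [← map_smul]
  congr 1
  simp only [beam, facetForce, scale, map_smul, LinearMap.smul_apply]
  rw [smul_comm]

variable (n k) in
/-- The pairs of vector measures that are sums of `k`-beams. -/
def beamSubmodule : Submodule ℝ (VectorMeasure E E × VectorMeasure E E) where
  carrier := {x | ∃ (m : ℕ) (P : Fin m → StressedSimplex n k), (∀ j, (P j).IsStructural) ∧
    x = ∑ j, (P j).beam.measures}
  zero_mem' := ⟨0, Fin.elim0, fun j => j.elim0, by simp⟩
  add_mem' := by
    rintro _ _ ⟨m, P, hP, rfl⟩ ⟨m', P', hP', rfl⟩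
    refine ⟨m + m', Fin.append P P', fun j => ?_, ?_⟩
    · refine Fin.addCases (fun j => ?_) (fun j => ?_) j
      · simpa using hP j
      · simpa using hP' j
    · simp [Fin.sum_univ_add]
  smul_mem' := by
    rintro c _ ⟨m, P, hP, rfl⟩
    refine ⟨m, fun j => (P j).scale c, fun j => (hP j).scale c, ?_⟩
    simp [Finset.smul_sum, StressedSimplex.measures_beam_scale]

end VectorMeasures

/-! ### Forces modulo beams slide -/

section ForceClass

variable {n d : ℕ}

local notation "E" => EuclideanSpace ℝ (Fin n)

/-- The class of a uniformly distributed force modulo `(d + 1)`-beams. -/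
def forceClass (n d : ℕ) (a : Fin (d + 1) → EuclideanSpace ℝ (Fin n)) :
    EuclideanSpace ℝ (Fin n) →ₗ[ℝ] _ ⧸ beamSubmodule n (d + 1) :=
  (beamSubmodule n (d + 1)).mkQ ∘ₗ setForce d (convexHull ℝ (Set.range a))

lemma forceClass_comp_perm (a : Fin (d + 1) → E) (σ : Equiv.Perm (Fin (d + 1))) :
    forceClass n d (a ∘ σ) = forceClass n d a := by
  rw [forceClass, σ.surjective.range_comp, forceClass]

/-- The beam lives on the simplex spanned by `a` and the extra vertex `a i + F`, with stress along
the edge `F`. The loaded facets are the old and the moved simplex; their products of area and height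
agree, so the forces are exactly opposite. -/
lemma forceClass_slide (a : Fin (d + 1) → E) (i : Fin (d + 1)) (F : E)
    (h : Transversal a ![F]) (hi : d = 0 ∨ i ≠ 0) :
    forceClass n d (a + Pi.single i F) F = forceClass n d a F := by
  let s : Affine.Simplex ℝ E (d + 1) :=
    ⟨Fin.snoc a (a i + F), transversal_iff_affineIndependent.1 (h.snoc i)⟩
  have hl : s.points (Fin.last _) = a i + F :=
    Fin.snoc_last (α := fun _ => E) (a i + F) a
  have hc (j : Fin (d + 1)) : s.points j.castSucc = a j :=
    Fin.snoc_castSucc (α := fun _ => E) (a i + F) a j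
  have hpq : Fin.last (d + 1) ≠ i.castSucc := (Fin.castSucc_lt_last i).ne'
  have hF : s.points (Fin.last _) - s.points i.castSucc = F := by
    rw [hl, hc]
    abel
  have hp : Set.range (s.faceOpposite (Fin.last _)).points = Set.range a := by
    rw [Affine.Simplex.range_faceOpposite_points]
    ext x
    simp only [Set.mem_image, Set.mem_compl_iff, Set.mem_singleton_iff, Set.mem_range]
    constructor
    · rintro ⟨j, hj, rfl⟩
      obtain ⟨j, rfl⟩ := Fin.exists_castSucc_eq.2 hj
      exact ⟨j, (hc j).symm⟩
    · rintro ⟨j, rfl⟩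
      exact ⟨j.castSucc, (Fin.castSucc_lt_last j).ne, hc j⟩
  have hq : Set.range (s.faceOpposite i.castSucc).points =
      Set.range (a + Pi.single i F : Fin (d + 1) → E) := by
    rw [Affine.Simplex.range_faceOpposite_points]
    ext x
    simp only [Set.mem_image, Set.mem_compl_iff, Set.mem_singleton_iff, Set.mem_range]
    constructor
    · rintro ⟨j, hj, rfl⟩
      refine Fin.lastCases (fun _ => ⟨i, by simp [hl]⟩) (fun j hj => ⟨j, ?_⟩) j hj
      have hj' : j ≠ i := fun h => hj (by rw [h])
      simp [hc, hj']
    · rintro ⟨j, rfl⟩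
      rcases eq_or_ne j i with rfl | hj
      · exact ⟨Fin.last _, hpq, by simp [hl]⟩
      · exact ⟨j.castSucc, by simpa using hj, by simp [hc, hj]⟩
  have harea := area_faceOpposite_mul_height_eq s (p := Fin.last _) (q := i.castSucc)
    (hi.imp_right fun hi => ⟨Fin.last_pos.ne', by simpa using hi⟩)
  have hpos : area (s.faceOpposite i.castSucc) * s.height i.castSucc ≠ 0 :=
    (mul_pos (area_pos _) (s.height_pos _)).ne'
  -- Normalizes the two facet forces to `F` and `-F`.
  set c := (area (s.faceOpposite i.castSucc) * s.height i.castSucc)⁻¹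
  let P := rankOneStress s c (s.points (Fin.last _) - s.points i.castSucc)
  have hP : P.beam.measures ∈ beamSubmodule n (d + 1) :=
    ⟨1, fun _ => P, fun _ => rankOneStress_isStructural s c _ _, by simp⟩
  have hsum : P.beam.measures =
      setForce d (convexHull ℝ (Set.range (a + Pi.single i F : Fin (d + 1) → E))) F -
        setForce d (convexHull ℝ (Set.range a)) F := by
    rw [ForceSystem.measures_eq_sum, Finset.sum_eq_add (Fin.last _) i.castSucc hpq]
    · change setForce d (convexHull ℝ (Set.range (s.faceOpposite (Fin.last _)).points))
          (P.facetForce _) + setForce d (convexHull ℝ (Set.range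
            (s.faceOpposite i.castSucc).points)) (P.facetForce _) = _
      rw [hp, hq, facetForce_rankOneStress_left s c hpq, facetForce_rankOneStress_right s c hpq,
        harea, inv_mul_cancel₀ hpos, hF, one_smul, neg_one_smul, map_neg]
      abel
    · rintro j - ⟨hj1, hj2⟩
      change setForce d _ (P.facetForce j) = 0
      rw [facetForce_rankOneStress_of_ne s c hj1 hj2, map_zero]
    · simp
    · simp
  rw [hsum] at hP
  exact (Submodule.Quotient.eq _).2 hP

lemma sliding_forceClass : Sliding (forceClass n d) where
  comp_perm := forceClass_comp_perm
  slide a i F h := by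
    by_cases hi : d = 0 ∨ i ≠ 0
    · exact forceClass_slide a i F h hi
    · push Not at hi
      obtain ⟨hd, rfl⟩ := hi
      -- Renumbering the vertices makes the moved one the last, which is not 0 as `d ≠ 0`.
      rw [← forceClass_comp_perm (a + _) (Equiv.swap 0 (Fin.last d)), add_single_comp_swap,
        ← forceClass_comp_perm a (Equiv.swap 0 (Fin.last d))]
      refine forceClass_slide _ _ F (h.comp_perm _) (Or.inr ?_)
      simpa using hd

end ForceClass

/-! ### Equilibrium and conclusion -/

/-- An alternating bilinear map vanishes on a sum of zero torque. -/
lemma sum_eq_zero_of_wedge {n l : ℕ} {Q : Type*} [AddCommGroup Q] [Module ℝ Q]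
    {γ : EuclideanSpace ℝ (Fin n) →ₗ[ℝ] EuclideanSpace ℝ (Fin n) →ₗ[ℝ] Q} (hγ : γ.IsAlt)
    (F c : Fin l → EuclideanSpace ℝ (Fin n)) (h : ∑ i, wedge (F i) (c i) = 0) :
    ∑ i, γ (c i) (F i) = 0 := by
  let b := (EuclideanSpace.basisFun (Fin n) ℝ).toBasis
  have hexp (u v : EuclideanSpace ℝ (Fin n)) : γ u v = ∑ p, ∑ q, (u p * v q) • γ (b p) (b q) := by
    conv_lhs => rw [← b.sum_repr u, ← b.sum_repr v]
    simp only [map_sum, LinearMap.sum_apply, map_smul, LinearMap.smul_apply, Finset.smul_sum,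
      smul_smul]
    rw [Finset.sum_comm]
    refine Finset.sum_congr rfl fun p _ => Finset.sum_congr rfl fun q _ => ?_
    simp [b, mul_comm]
  have h2 (u v : EuclideanSpace ℝ (Fin n)) :
      (2 : ℝ) • γ v u = -∑ p, ∑ q, wedge u v p q • γ (b p) (b q) := by
    rw [two_smul]
    nth_rewrite 1 [← hγ.neg u v]
    rw [hexp u v, hexp v u]
    simp only [wedge, Matrix.of_apply, sub_smul, Finset.sum_sub_distrib]
    abel
  have h3 : (2 : ℝ) • ∑ i, γ (c i) (F i) = 0 := by
    rw [Finset.smul_sum]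
    simp only [h2, Finset.sum_neg_distrib, neg_eq_zero]
    rw [Finset.sum_comm]
    refine Finset.sum_eq_zero fun p _ => ?_
    rw [Finset.sum_comm]
    refine Finset.sum_eq_zero fun q _ => ?_
    rw [← Finset.sum_smul, ← Matrix.sum_apply, h]
    simp
  exact (smul_eq_zero.1 h3).resolve_left two_ne_zero

theorem ForceSystem.InEquilibrium.measures_mem {n d l : ℕ} (hn : d + 2 ≤ n)
    {S : ForceSystem n d l} (hS : S.InEquilibrium) : S.measures ∈ beamSubmodule n (d + 1) := by
  obtain ⟨δ, γ, hγ, h⟩ := (sliding_forceClass (n := n) (d := d)).exists_eq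
    (by rwa [Fintype.card_fin, finrank_euclideanSpace_fin])
  refine (Submodule.Quotient.mk_eq_zero (beamSubmodule n (d + 1))).1 ?_
  change (beamSubmodule n (d + 1)).mkQ _ = 0
  rw [S.measures_eq_sum, map_sum]
  have h1 (i : Fin l) : (beamSubmodule n (d + 1)).mkQ
      (setForce d (convexHull ℝ (Set.range (S.simplex i).points)) (S.force i)) =
        -- The sum of the `d + 1` vertices is `d + 1` times the barycenter.
        δ (S.force i) + ((d : ℝ) + 1) • γ (S.simplex i).centroid (S.force i) := by
    have h2 := (S.simplex i).centroid_vsub_eq 0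
    simp only [vsub_eq_sub, sub_zero] at h2
    rw [h2, map_smul, LinearMap.smul_apply, smul_inv_smul₀ (by positivity)]
    exact h _ (transversal_iff_affineIndependent.2 (S.simplex i).independent) _
  rw [Finset.sum_congr rfl fun i _ => h1 i, Finset.sum_add_distrib, ← map_sum, hS.1, map_zero,
    ← Finset.smul_sum, sum_eq_zero_of_wedge hγ _ _ hS.2, smul_zero, add_zero]

end Beams

end

theorem mainTheorem1 (k n l : ℕ) [NeZero k] (hn : k + 1 ≤ n)
    (S : Beams.ForceSystem n (k - 1) l) (hS : S.InEquilibrium) :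
    ∃ (m : ℕ) (P : Fin m → Beams.StressedSimplex n k),
      (∀ j, (P j).IsStructural) ∧
      S.uniformMeasure = ∑ j, (P j).beam.uniformMeasure ∧
      S.densityMeasure = ∑ j, (P j).beam.densityMeasure := by
  obtain ⟨d, rfl⟩ := Nat.exists_eq_succ_of_ne_zero (NeZero.ne k)
  obtain ⟨m, P, hP, h⟩ := hS.measures_mem hn
  refine ⟨m, P, hP, ?_, ?_⟩
  · simpa [Prod.fst_sum, Beams.ForceSystem.measures] using congrArg Prod.fst h
  · simpa [Prod.snd_sum, Beams.ForceSystem.measures] using congrArg Prod.snd h
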